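/- A contextuality scenario is a pair $\mathbb{G}=(V,E)$, where $V$ is a finite set and $E$ is a non-empty set of subsets of $V$ with $\bigcup_{e\in E}e=V$. A probabilistic model of $\mathbb{G}$ is a function $p:V\to[0,1]$ with $\sum_{x\in e}p(x)=1$ for all $e\in E$; the set of these is $\mathcal{G}(\mathbb{G})$, and $\mathbb{G}$ is non-trivial if $\mathcal{G}(\mathbb{G})\neq\emptyset$. Let $\mathcal{S}=\bigoplus_{e\in E}\ell^\infty_e$ (with its usual operator system structure, $\ell^\infty_e=\mathbb{C}^e$), let $\tilde{\mathcal{J}}_{\mathbb{G}}=\{u\in\mathcal{S}:\sum_{e\in E}\sum_{x\in e}p(x)u^e_x=0\text{ for all }p\in\mathcal{G}(\mathbb{G})\}$, let $\mathcal{S}_{\mathbb{G}}=\mathcal{S}/\tilde{\mathcal{J}}_{\mathbb{G}}$ be the operator system quotient, with quotient map $q$, and let $a_x=|E|\,q(\delta^e_x)$ for $x\in e\in E$, where $\delta^e_x$ is the canonical basis vector of the summand $\ell^\infty_e$ (this does not depend on the choice of $e$). Here $u\in M_n(\mathcal{S}/\tilde{\mathcal{J}}_{\mathbb{G}})$ is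 positive if, for every $\varepsilon>0$, $\varepsilon 1+u$ has a lift in $M_n(\mathcal{S})^+$. For operator systems $\mathcal{R},\mathcal{T}$, the cone $M_n(\mathcal{R}\otimes_{\max}\mathcal{T})^+$ consists of all $z\in M_n(\mathcal{R}\otimes\mathcal{T})$ such that for every $\varepsilon>0$ there are $k,m\in\mathbb{N}$, $P\in M_k(\mathcal{R})^+$, $Q\in M_m(\mathcal{T})^+$ and $\alpha\in M_{n,km}$ with $\varepsilon 1+z=\alpha(P\otimes Q)\alpha^*$. A state is a positive unital linear functional. Let $\mathbb{G}=(V,E)$ and $\mathbb{H}=(W,F)$ be non-trivial contextuality scenarios, let $a_x$ $(x\in V)$ and $b_y$ $(y\in W)$ be the canonical generators of $\mathcal{S}_{\mathbb{G}}$ and $\mathcal{S}_{\mathbb{H}}$, and let $\mathbb{G}\times\mathbb{H}=(V\times W,\{e\times f:e\in E,f\in F\})$. A probabilistic model $p$ of $\mathbb{G}\times\mathbb{H}$ is no-signalling if $\sum_{x\in e}p(x,y)=\sum_{x\in e'}p(x,y)$ for all $y\in W$, $e,e'\in E$, and $\sum_{y\in f}p(x,y)=\sum_{y\in f'}p(x,y)$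 for all $x\in V$, $f,f'\in F$; the set of these is $\mathcal{G}_{\rm ns}(\mathbb{G},\mathbb{H})$. For a linear functional $s$ on $\mathcal{S}_{\mathbb{G}}\otimes\mathcal{S}_{\mathbb{H}}$ put $p^s(x,y)=s(a_x\otimes b_y)$. Theorem. For every probabilistic model $p$ of $\mathbb{G}\times\mathbb{H}$ the following are equivalent: (i) $p\in\mathcal{G}_{\rm ns}(\mathbb{G},\mathbb{H})$; (ii) there is a state $s$ of $\mathcal{S}_{\mathbb{G}}\otimes_{\max}\mathcal{S}_{\mathbb{H}}$ with $p=p^s$. Moreover, the map $s\mapsto p^s$ is an affine isomorphism (a bijection preserving convex combinations between convex sets) from the state space of $\mathcal{S}_{\mathbb{G}}\otimes_{\max}\mathcal{S}_{\mathbb{H}}$ onto $\mathcal{G}_{\rm ns}(\mathbb{G},\mathbb{H})$. -/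

import Mathlib

noncomputable section

open scoped TensorProduct ComplexOrder

/-! ### Matrix orderings, states, quotients and maximal tensor products -/

section OperatorSystems

/-- A family of sets of `n × n` matrices over `S`, `n ∈ ℕ`; used for the matricial cones
`M_n(S)⁺` of an operator system `S`. -/
abbrev MatrixCones (S : Type*) := (n : ℕ) → Set (Matrix (Fin n) (Fin n) S)

/-- The positive elements of `S` itself, i.e. the first cone `M_1(S)⁺ = S⁺`. -/
def positiveElements {S : Type*} (C : MatrixCones S) : Set S :=
  {x | (Matrix.of fun _ _ : Fin 1 => x) ∈ C 1}

/-- The Archimedeanization of a family of cones with respect to the matrix order unit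
determined by `e`: all `u` with `ε (I_n ⊗ e) + u ∈ D_n` for every `ε > 0`. -/
def archimedeanization {S : Type*} [AddCommGroup S] [Module ℂ S] (D : MatrixCones S) (e : S) :
    MatrixCones S :=
  fun n => {u | ∀ ε : ℝ, 0 < ε → (ε : ℂ) • Matrix.diagonal (fun _ : Fin n => e) + u ∈ D n}

/-- The matricial cones of the operator system quotient `S / J`:
`u ∈ M_n(S / J)` is positive if, for every `ε > 0`, the element `ε 1 + u` has a positive lift
in `M_n(S)`. -/
def quotientCones {S : Type*} [AddCommGroup S] [Module ℂ S] (C : MatrixCones S) (e : S)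
    (J : Submodule ℂ S) : MatrixCones (S ⧸ J) :=
  archimedeanization (fun n => (fun v => v.map J.mkQ) '' C n) (J.mkQ e)

/-- The element `α (P ⊗ Q) α*` of `M_n(S ⊗ T)`, where `P ∈ M_k(S)`, `Q ∈ M_m(T)` and
`α` is a scalar `n × km` matrix. -/
def compressedTensor {S T : Type*} [AddCommGroup S] [Module ℂ S] [AddCommGroup T] [Module ℂ T]
    {n k m : ℕ} (α : Matrix (Fin n) (Fin k × Fin m) ℂ)
    (P : Matrix (Fin k) (Fin k) S) (Q : Matrix (Fin m) (Fin m) T) :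
    Matrix (Fin n) (Fin n) (S ⊗[ℂ] T) :=
  Matrix.of fun i j => ∑ a : Fin k × Fin m, ∑ b : Fin k × Fin m,
    (α i a * star (α j b)) • (P a.1 b.1 ⊗ₜ[ℂ] Q a.2 b.2)

/-- The matricial cones of the maximal tensor product `S ⊗_max T`: the Archimedeanization of
the family `D_n = {α (P ⊗ Q) α* : P ∈ M_k(S)⁺, Q ∈ M_m(T)⁺, α ∈ M_{n,km}, k, m ∈ ℕ}`. -/
def maxTensorCones {S T : Type*} [AddCommGroup S] [Module ℂ S] [AddCommGroup T] [Module ℂ T]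
    (C : MatrixCones S) (e : S) (D : MatrixCones T) (f : T) : MatrixCones (S ⊗[ℂ] T) :=
  archimedeanization
    (fun n => {z | ∃ (k m : ℕ), ∃ P ∈ C k, ∃ Q ∈ D m, ∃ α : Matrix (Fin n) (Fin k × Fin m) ℂ,
      z = compressedTensor α P Q})
    (e ⊗ₜ[ℂ] f)

/-- The state space: all positive unital linear functionals. -/
def stateSpace {S : Type*} [AddCommGroup S] [Module ℂ S] (C : MatrixCones S) (e : S) :
    Set (S →ₗ[ℂ] ℂ) :=
  {s | s e = 1 ∧ ∀ x ∈ positiveElements C, 0 ≤ s x}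

/-- A map between subsets of real vector spaces is an affine isomorphism: both sets are convex,
the map is a bijection, and it preserves convex combinations. -/
def IsAffineIso {X Y : Type*} [AddCommGroup X] [Module ℝ X] [AddCommGroup Y] [Module ℝ Y]
    {K : Set X} {L : Set Y} (Φ : K → L) : Prop :=
  Convex ℝ K ∧ Convex ℝ L ∧ Function.Bijective Φ ∧
    ∀ (s t u : K) (c : ℝ), 0 ≤ c → c ≤ 1 → (u : X) = c • (s : X) + (1 - c) • (t : X) →
      (Φ u : Y) = c • (Φ s : Y) + (1 - c) • (Φ t : Y)

end OperatorSystems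

/-! ### Contextuality scenarios -/

/-- A contextuality scenario with outcome set `V`: a non-empty set `E` of subsets of `V`
(the measurements) that covers `V`. -/
structure ContextualityScenario (V : Type*) where
  edges : Finset (Finset V)
  edges_nonempty : edges.Nonempty
  exists_mem_edge : ∀ x : V, ∃ e ∈ edges, x ∈ e

namespace ContextualityScenario

variable {V W : Type*}

/-- The probabilistic models of `G`. -/
def models (G : ContextualityScenario V) : Set (V → ℝ) :=
  {p | (∀ x, 0 ≤ p x ∧ p x ≤ 1) ∧ ∀ e ∈ G.edges, ∑ x ∈ e, p x = 1}

/-- A scenario is non-trivial if it admits a probabilistic model. -/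
def IsNontrivial (G : ContextualityScenario V) : Prop := G.models.Nonempty

/-- The product scenario: outcomes `V × W`, measurements `e × f`. -/
def prod [DecidableEq V] [DecidableEq W] (G : ContextualityScenario V)
    (H : ContextualityScenario W) : ContextualityScenario (V × W) where
  edges := (G.edges ×ˢ H.edges).image fun ef => ef.1 ×ˢ ef.2
  edges_nonempty := (G.edges_nonempty.product H.edges_nonempty).image _
  exists_mem_edge := by
    rintro ⟨x, y⟩
    obtain ⟨e, he, hx⟩ := G.exists_mem_edge x
    obtain ⟨f, hf, hy⟩ := H.exists_mem_edge y
    exact ⟨e ×ˢ f, Finset.mem_image.2 ⟨(e, f), Finset.mem_product.2 ⟨he, hf⟩, rfl⟩,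
      Finset.mem_product.2 ⟨hx, hy⟩⟩

/-- The no-signalling probabilistic models of `G × H`. -/
def nsModels [DecidableEq V] [DecidableEq W] (G : ContextualityScenario V)
    (H : ContextualityScenario W) : Set (V × W → ℝ) :=
  {p | p ∈ (G.prod H).models ∧
    (∀ y : W, ∀ e ∈ G.edges, ∀ e' ∈ G.edges, ∑ x ∈ e, p (x, y) = ∑ x ∈ e', p (x, y)) ∧
    (∀ x : V, ∀ f ∈ H.edges, ∀ f' ∈ H.edges, ∑ y ∈ f, p (x, y) = ∑ y ∈ f', p (x, y))}

/-- The direct sum `⊕_{e ∈ E} ℓ^∞_e`. -/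
abbrev DirectSumSystem (G : ContextualityScenario V) : Type _ :=
  (e : {e // e ∈ G.edges}) → {x // x ∈ e.1} → ℂ

/-- The cones of `⊕_{e ∈ E} ℓ^∞_e`, where `M_n(⊕_e ℓ^∞_e) = ⊕_e ⊕_{x ∈ e} M_n`. -/
def directSumCones (G : ContextualityScenario V) : MatrixCones G.DirectSumSystem :=
  fun _ => {u | ∀ (e : {e // e ∈ G.edges}) (x : {x // x ∈ e.1}),
    (u.map fun v => v e x).PosSemidef}

/-- The pairing `⟨p, u⟩ = ∑_e ∑_{x ∈ e} p(x) u_x^e`, linear in `u`. -/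
def pairing (G : ContextualityScenario V) (p : V → ℝ) : G.DirectSumSystem →ₗ[ℂ] ℂ where
  toFun u := ∑ e : {e // e ∈ G.edges}, ∑ x : {x // x ∈ e.1}, (p x : ℂ) * u e x
  map_add' u v := by simp [mul_add, Finset.sum_add_distrib]
  map_smul' c u := by simp [Finset.mul_sum, mul_left_comm]

/-- The kernel of the quotient: all `u` with `⟨p, u⟩ = 0` for every probabilistic model `p`. -/
def modelKernel (G : ContextualityScenario V) : Submodule ℂ G.DirectSumSystem :=
  ⨅ p ∈ G.models, LinearMap.ker (G.pairing p)

/-- The underlying vector space of the universal operator system `S_G`, the quotient of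
`⊕_{e ∈ E} ℓ^∞_e` by `modelKernel`. -/
abbrev UniversalSystem (G : ContextualityScenario V) : Type _ :=
  G.DirectSumSystem ⧸ G.modelKernel

/-- The unit of `S_G`. -/
def universalUnit (G : ContextualityScenario V) : G.UniversalSystem :=
  G.modelKernel.mkQ 1

/-- The matricial cones of `S_G`. -/
def universalCones (G : ContextualityScenario V) : MatrixCones G.UniversalSystem :=
  quotientCones G.directSumCones 1 G.modelKernel

variable [DecidableEq V] [DecidableEq W]

/-- The element `δ_x^e` of the `e`-th summand, inside `⊕_{f ∈ E} ℓ^∞_f`. -/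
def delta (G : ContextualityScenario V) (e : {e // e ∈ G.edges}) (x : {x // x ∈ e.1}) :
    G.DirectSumSystem :=
  Pi.single e (Pi.single x 1)

/-- The canonical generator `a_x = |E| q(δ_x^e)` of `S_G`, for any measurement `e` with `x ∈ e`;
see `generator_eq` for the independence of `e`. -/
def generator (G : ContextualityScenario V) (x : V) : G.UniversalSystem :=
  (G.edges.card : ℂ) • G.modelKernel.mkQ
    (G.delta ⟨(G.exists_mem_edge x).choose, (G.exists_mem_edge x).choose_spec.1⟩
      ⟨x, (G.exists_mem_edge x).choose_spec.2⟩)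

theorem pairing_delta (G : ContextualityScenario V) (p : V → ℝ) (e : {e // e ∈ G.edges})
    (x : {x // x ∈ e.1}) : G.pairing p (G.delta e x) = p x := by
  show ∑ e' : {e // e ∈ G.edges}, ∑ x' : {x // x ∈ e'.1}, (p x' : ℂ) * G.delta e x e' x' = _
  rw [Finset.sum_eq_single e, Finset.sum_eq_single x]
  · simp [delta]
  · intro b _ hb
    simp [delta, hb]
  · simp
  · intro b _ hb
    simp [delta, Pi.single_eq_of_ne hb]
  · simp

theorem generator_eq (G : ContextualityScenario V) (x : V) (e : Finset V) (he : e ∈ G.edges)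
    (hx : x ∈ e) :
    G.generator x = (G.edges.card : ℂ) • G.modelKernel.mkQ (G.delta ⟨e, he⟩ ⟨x, hx⟩) := by
  unfold generator
  congr 1
  rw [← sub_eq_zero, ← map_sub, Submodule.mkQ_apply, Submodule.Quotient.mk_eq_zero, modelKernel]
  simp only [Submodule.mem_iInf, LinearMap.mem_ker, map_sub, pairing_delta, sub_self,
    implies_true]

/-- The states of the maximal tensor product `S_G ⊗_max S_H`. -/
def maxTensorStates (G : ContextualityScenario V) (H : ContextualityScenario W) :
    Set (G.UniversalSystem ⊗[ℂ] H.UniversalSystem →ₗ[ℂ] ℂ) :=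
  stateSpace (maxTensorCones G.universalCones G.universalUnit H.universalCones H.universalUnit)
    (G.universalUnit ⊗ₜ[ℂ] H.universalUnit)

/-- The function `p^s(x, y) = s(a_x ⊗ b_y)` of a linear functional `s` on `S_G ⊗ S_H`. -/
def modelOf (G : ContextualityScenario V) (H : ContextualityScenario W)
    (s : G.UniversalSystem ⊗[ℂ] H.UniversalSystem →ₗ[ℂ] ℂ) (z : V × W) : ℂ :=
  s (G.generator z.1 ⊗ₜ[ℂ] H.generator z.2)

end ContextualityScenario

end

/-!
A state of `S ⊗_max T` is a unital bilinear form `B` on `S × T` that sends each pair of positive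
matrices `P`, `Q` to a positive semidefinite scalar matrix `(B (P a c) (Q b d))`. On the direct
sums `⊕_e ℓ^∞_e` and `⊕_f ℓ^∞_f` a non-negative function `p` gives a form with this positivity,
`(u, v) ↦ ∑ p(x, y) u_x^e v_y^f`, because Kronecker products of positive semidefinite matrices are
positive semidefinite. It descends to the quotients when `p` is no-signalling: each slice `p(·, y)`
is then zero or a multiple of a probabilistic model, hence annihilates the kernel, and likewise for
`p(x, ·)`. Conversely, `∑_{x ∈ e} a_x = 1` for every measurement `e`, so the marginals
`s(1 ⊗ b_y)` and `s(a_x ⊗ 1)` of a state do not depend on the measurement. The generators span, so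
a state is determined by its model.
-/

open scoped TensorProduct ComplexOrder

theorem mem_of_isClosed_of_forall_pos {X : Type*} [TopologicalSpace X] {s : Set X}
    (hs : IsClosed s) {f : ℝ → X} (hf : Continuous f) (h : ∀ ε, 0 < ε → f ε ∈ s) : f 0 ∈ s :=
  hs.mem_of_tendsto ((hf.tendsto 0).mono_left (nhdsWithin_le_nhds (s := Set.Ioi 0)))
    (eventually_nhdsWithin_of_forall h)

theorem isClosed_setOf_posSemidef {n 𝕜 : Type*} [Finite n] [RCLike 𝕜] :
    IsClosed {M : Matrix n n 𝕜 | M.PosSemidef} := by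
  cases nonempty_fintype n
  simp only [Matrix.posSemidef_iff_dotProduct_mulVec, Set.ofPred_and, Set.ofPred_forall]
  refine (isClosed_eq continuous_id.matrix_conjTranspose continuous_id).inter
    (isClosed_iInter fun x => isClosed_le continuous_const ?_)
  exact continuous_const.dotProduct (continuous_id.matrix_mulVec continuous_const)

theorem isAffineIso_of_bijOn {X Y : Type*} [AddCommGroup X] [Module ℝ X] [AddCommGroup Y]
    [Module ℝ Y] {K : Set X} {L : Set Y} {φ : X →ₗ[ℝ] Y} (hK : Convex ℝ K)
    (hφ : Set.BijOn φ K L) : IsAffineIso (hφ.mapsTo.restrict φ K L) := by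
  refine ⟨hK, hφ.image_eq ▸ hK.linear_image φ, hφ.bijective, fun s t u c _ _ hu => ?_⟩
  simp only [Set.MapsTo.val_restrict_apply, hu, map_add, map_smul]

section OperatorSystems

variable {S T : Type*} [AddCommGroup S] [Module ℂ S] [AddCommGroup T] [Module ℂ T]
  {C : MatrixCones S} {D : MatrixCones T} {e : S} {f : T}

theorem convex_stateSpace (C : MatrixCones S) (e : S) : Convex ℝ (stateSpace C e) := by
  rintro s ⟨hs_unit, hs⟩ t ⟨ht_unit, ht⟩ a b ha hb hab
  refine ⟨?_, fun x hx => ?_⟩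
  · simpa [hs_unit, ht_unit] using mod_cast hab
  · exact add_nonneg (smul_nonneg ha (hs x hx)) (smul_nonneg hb (ht x hx))

theorem nonneg_of_mem_positiveElements_archimedeanization {s : S →ₗ[ℂ] ℂ}
    (hs : ∀ x ∈ positiveElements C, 0 ≤ s x) {x : S}
    (hx : x ∈ positiveElements (archimedeanization C e)) : 0 ≤ s x := by
  have hpos : ∀ ε : ℝ, 0 < ε → 0 ≤ (ε : ℂ) * s e + s x := by
    intro ε hε
    have hmem : (ε : ℂ) • e + x ∈ positiveElements C := by
      change Matrix.of _ ∈ C 1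
      convert hx ε hε
      ext i j
      simp [Subsingleton.elim i j]
    simpa using hs _ hmem
  simpa using mem_of_isClosed_of_forall_pos (isClosed_Ici (a := (0 : ℂ)))
    (f := fun ε : ℝ => (ε : ℂ) * s e + s x) (by fun_prop) hpos

theorem map_mkQ_mem_quotientCones (J : Submodule ℂ S) {n : ℕ} {P : Matrix (Fin n) (Fin n) S}
    (hP : P ∈ archimedeanization C e n) : P.map J.mkQ ∈ quotientCones C e J n := by
  intro ε hε
  refine ⟨_, hP ε hε, ?_⟩
  ext i j
  by_cases hij : i = j <;> simp [hij]

/-- Joint complete positivity of a bilinear form `B` on `S × T` for the cones `C` and `D`: for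
`P ∈ M_k(S)⁺` and `Q ∈ M_m(T)⁺` the scalar `km × km` matrix with entries `B (P a c) (Q b d)` is
positive semidefinite. Such forms induce the positive functionals on `S ⊗_max T`. -/
def IsJointlyCompletelyPositive (C : MatrixCones S) (D : MatrixCones T)
    (B : S →ₗ[ℂ] T →ₗ[ℂ] ℂ) : Prop :=
  ∀ ⦃k m : ℕ⦄, ∀ P ∈ C k, ∀ Q ∈ D m, (Matrix.kroneckerMapBilinear B P Q).PosSemidef

namespace IsJointlyCompletelyPositive

variable {B : S →ₗ[ℂ] T →ₗ[ℂ] ℂ}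

theorem smul (hB : IsJointlyCompletelyPositive C D B) {c : ℂ} (hc : 0 ≤ c) :
    IsJointlyCompletelyPositive C D (c • B) :=
  fun _ _ P hP Q hQ => (hB P hP Q hQ).smul hc

theorem sum {ι : Type*} {s : Finset ι} {B : ι → S →ₗ[ℂ] T →ₗ[ℂ] ℂ}
    (hB : ∀ i ∈ s, IsJointlyCompletelyPositive C D (B i)) :
    IsJointlyCompletelyPositive C D (∑ i ∈ s, B i) := by
  intro k m P hP Q hQ
  convert Matrix.posSemidef_sum s fun i hi => hB i hi P hP Q hQ
  ext a b
  simp [Matrix.sum_apply]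

theorem smulRight {φ : S →ₗ[ℂ] ℂ} {ψ : T →ₗ[ℂ] ℂ}
    (hφ : ∀ n, ∀ P ∈ C n, (P.map φ).PosSemidef) (hψ : ∀ n, ∀ Q ∈ D n, (Q.map ψ).PosSemidef) :
    IsJointlyCompletelyPositive C D (φ.smulRight ψ) :=
  fun k m P hP Q hQ => (hφ k P hP).kronecker (hψ m Q hQ)

theorem archimedeanization (hB : IsJointlyCompletelyPositive C D B) (e : S) (f : T) :
    IsJointlyCompletelyPositive (archimedeanization C e) (archimedeanization D f) B := by
  intro k m P hP Q hQ
  have hlim := mem_of_isClosed_of_forall_pos isClosed_setOf_posSemidef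
    (f := fun ε : ℝ => Matrix.kroneckerMapBilinear B
      ((ε : ℂ) • Matrix.diagonal (fun _ => e) + P) ((ε : ℂ) • Matrix.diagonal (fun _ => f) + Q))
    (by simp only [map_add, map_smul, LinearMap.add_apply, LinearMap.smul_apply]; fun_prop)
    (fun ε hε => hB _ (hP ε hε) _ (hQ ε hε))
  simpa using hlim

theorem quotientCones {J : Submodule ℂ S} {K : Submodule ℂ T} {B : S ⧸ J →ₗ[ℂ] T ⧸ K →ₗ[ℂ] ℂ}
    (hB : IsJointlyCompletelyPositive C D (B.compl₁₂ J.mkQ K.mkQ)) (e : S) (f : T) :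
    IsJointlyCompletelyPositive (quotientCones C e J) (quotientCones D f K) B := by
  refine IsJointlyCompletelyPositive.archimedeanization ?_ _ _
  rintro k m _ ⟨P, hP, rfl⟩ _ ⟨Q, hQ, rfl⟩
  exact hB P hP Q hQ

theorem lift_compressedTensor_nonneg (hB : IsJointlyCompletelyPositive C D B) {n k m : ℕ}
    {P : Matrix (Fin k) (Fin k) S} (hP : P ∈ C k) {Q : Matrix (Fin m) (Fin m) T} (hQ : Q ∈ D m)
    (α : Matrix (Fin n) (Fin k × Fin m) ℂ) (i : Fin n) :
    0 ≤ TensorProduct.lift B (compressedTensor α P Q i i) := by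
  simpa [compressedTensor, dotProduct, Matrix.mulVec, Finset.mul_sum, mul_assoc, mul_comm,
    mul_left_comm] using (hB P hP Q hQ).dotProduct_mulVec_nonneg (star (α i))

theorem lift_mem_stateSpace (hB : IsJointlyCompletelyPositive C D B) (hunit : B e f = 1) :
    TensorProduct.lift B ∈ stateSpace (maxTensorCones C e D f) (e ⊗ₜ f) := by
  refine ⟨by simpa using hunit, fun z hz => ?_⟩
  refine nonneg_of_mem_positiveElements_archimedeanization ?_ hz
  rintro x ⟨k, m, P, hP, Q, hQ, α, hx⟩
  have hx' : x = compressedTensor α P Q 0 0 := congrFun (congrFun hx 0) 0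
  exact hx' ▸ hB.lift_compressedTensor_nonneg hP hQ α 0

end IsJointlyCompletelyPositive

theorem tmul_mem_positiveElements_maxTensorCones {a : S} {b : T}
    (ha : Matrix.diagonal ![e, a] ∈ C 2) (hb : Matrix.diagonal ![f, b] ∈ D 2) :
    a ⊗ₜ[ℂ] b ∈ positiveElements (maxTensorCones C e D f) := by
  -- `ε (e ⊗ f) + a ⊗ b` is the compression of `diag(e, a) ⊗ diag(f, b)` by the row
  -- `√ε δ_(0, 0) + δ_(1, 1)`.
  intro ε hε
  refine ⟨2, 2, _, ha, _, hb, Matrix.of fun _ => Pi.single (0, 0) (√ε : ℂ) + Pi.single (1, 1) 1, ?_⟩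
  have hsq : (√ε : ℂ) * (√ε : ℂ) = ε := by
    rw [← Complex.ofReal_mul, Real.mul_self_sqrt hε.le]
  ext i j
  obtain rfl : i = j := Subsingleton.elim i j
  simp [compressedTensor, Fintype.sum_prod_type, Pi.single_apply, hsq]

end OperatorSystems

namespace ContextualityScenario

variable {V W : Type*} (G : ContextualityScenario V) (H : ContextualityScenario W)

theorem card_edges_ne_zero : (G.edges.card : ℂ) ≠ 0 :=
  Nat.cast_ne_zero.2 G.edges_nonempty.card_ne_zero

theorem mem_models_of_nonneg {p : V → ℝ} (hp : ∀ x, 0 ≤ p x)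
    (hsum : ∀ e ∈ G.edges, ∑ x ∈ e, p x = 1) : p ∈ G.models := by
  refine ⟨fun x => ⟨hp x, ?_⟩, hsum⟩
  obtain ⟨e, he, hx⟩ := G.exists_mem_edge x
  exact hsum e he ▸ Finset.single_le_sum (fun i _ => hp i) hx

theorem pairing_apply (p : V → ℝ) (u : G.DirectSumSystem) :
    G.pairing p u = ∑ e : {e // e ∈ G.edges}, ∑ x : {x // x ∈ e.1}, (p x : ℂ) * u e x :=
  rfl

theorem pairing_smul (c : ℝ) (p : V → ℝ) : G.pairing (c • p) = (c : ℂ) • G.pairing p := by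
  ext1 u
  simp [pairing_apply, Finset.mul_sum, mul_assoc]

theorem sum_ofReal_of_mem_models {p : V → ℝ} (hp : p ∈ G.models) {e : Finset V}
    (he : e ∈ G.edges) : ∑ x : {x // x ∈ e}, (p x : ℂ) = 1 := by
  rw [Finset.sum_coe_sort e fun x => (p x : ℂ)]
  exact_mod_cast hp.2 e he

theorem pairing_one {p : V → ℝ} (hp : p ∈ G.models) : G.pairing p 1 = G.edges.card := by
  simp only [pairing_apply, Pi.one_apply, mul_one, G.sum_ofReal_of_mem_models hp (Subtype.prop _)]
  simp

theorem mkQ_eq_mkQ_iff {u v : G.DirectSumSystem} :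
    G.modelKernel.mkQ u = G.modelKernel.mkQ v ↔
      ∀ p ∈ G.models, G.pairing p u = G.pairing p v := by
  rw [Submodule.mkQ_apply, Submodule.mkQ_apply, Submodule.Quotient.eq, modelKernel]
  simp only [Submodule.mem_iInf, LinearMap.mem_ker, map_sub, sub_eq_zero]

theorem modelKernel_le_ker_pairing {q : V → ℝ} (hq : ∀ x, 0 ≤ q x)
    (hsum : ∀ e ∈ G.edges, ∀ e' ∈ G.edges, ∑ x ∈ e, q x = ∑ x ∈ e', q x) :
    G.modelKernel ≤ LinearMap.ker (G.pairing q) := by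
  obtain ⟨e₀, he₀⟩ := G.edges_nonempty
  set c : ℝ := ∑ x ∈ e₀, q x
  rcases (Finset.sum_nonneg fun x _ => hq x : 0 ≤ c).eq_or_lt with hc | hc
  · have hq_zero : q = (0 : ℝ) • q := by
      ext x
      obtain ⟨e, he, hx⟩ := G.exists_mem_edge x
      have he_zero : ∑ x ∈ e, q x = 0 := (hsum e he e₀ he₀).trans hc.symm
      simpa using (Finset.sum_eq_zero_iff_of_nonneg fun i _ => hq i).1 he_zero x hx
    rw [hq_zero, pairing_smul]
    simp
  · have hmodel : c⁻¹ • q ∈ G.models := by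
      refine G.mem_models_of_nonneg (fun x => mul_nonneg (inv_nonneg.2 hc.le) (hq x)) ?_
      intro e he
      simp only [Pi.smul_apply, ← Finset.smul_sum, hsum e he e₀ he₀]
      exact inv_mul_cancel₀ hc.ne'
    calc G.modelKernel ≤ LinearMap.ker (G.pairing (c⁻¹ • q)) := iInf₂_le _ hmodel
      _ = LinearMap.ker (G.pairing q) := by
        rw [pairing_smul, LinearMap.ker_smul _ _ (by simpa using hc.ne')]

theorem diagonal_mem_directSumCones {n : ℕ} {d : Fin n → G.DirectSumSystem} (hd : 0 ≤ d) :
    Matrix.diagonal d ∈ G.directSumCones n := by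
  intro e x
  rw [Matrix.diagonal_map rfl]
  exact Matrix.PosSemidef.diagonal fun i => hd i e x

theorem diagonal_mkQ_mem_universalCones {n : ℕ} {d : Fin n → G.DirectSumSystem} (hd : 0 ≤ d) :
    Matrix.diagonal (fun i => G.modelKernel.mkQ (d i)) ∈ G.universalCones n := by
  have hdiag : Matrix.diagonal d ∈ archimedeanization G.directSumCones 1 n := by
    intro ε hε
    rw [← Matrix.diagonal_smul, Matrix.diagonal_add]
    refine G.diagonal_mem_directSumCones (add_nonneg (fun i e x => ?_) hd)
    simpa using hε.le
  have hmap := map_mkQ_mem_quotientCones G.modelKernel hdiag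
  rwa [Matrix.diagonal_map (map_zero _)] at hmap

section Generators

variable [DecidableEq V]

theorem sum_generator {e : Finset V} (he : e ∈ G.edges) :
    ∑ x ∈ e, G.generator x = G.universalUnit := by
  have hlift : ∑ x ∈ e, G.generator x =
      G.modelKernel.mkQ ((G.edges.card : ℂ) • ∑ x : {x // x ∈ e}, G.delta ⟨e, he⟩ x) := by
    rw [← Finset.sum_coe_sort, map_smul, map_sum, Finset.smul_sum]
    exact Finset.sum_congr rfl fun x _ => G.generator_eq x e he x.2
  rw [hlift, universalUnit, mkQ_eq_mkQ_iff]
  intro p hp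
  simp only [map_smul, map_sum, pairing_delta, G.sum_ofReal_of_mem_models hp he,
    G.pairing_one hp, smul_eq_mul, mul_one]

theorem directSumSystem_hom_ext {M : Type*} [AddCommGroup M] [Module ℂ M]
    {φ ψ : G.DirectSumSystem →ₗ[ℂ] M} (h : ∀ e x, φ (G.delta e x) = ψ (G.delta e x)) : φ = ψ :=
  LinearMap.pi_ext' fun e => LinearMap.pi_ext' fun x => LinearMap.ext_ring (h e x)

theorem universalSystem_hom_ext {M : Type*} [AddCommGroup M] [Module ℂ M]
    {φ ψ : G.UniversalSystem →ₗ[ℂ] M} (h : ∀ x, φ (G.generator x) = ψ (G.generator x)) :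
    φ = ψ := by
  refine Submodule.linearMap_qext _ <| G.directSumSystem_hom_ext fun e x => ?_
  have hx := h x
  rw [G.generator_eq x e.1 e.2 x.2, map_smul, map_smul] at hx
  exact smul_right_injective M G.card_edges_ne_zero hx

theorem diagonal_unit_generator_mem_universalCones (x : V) :
    Matrix.diagonal ![G.universalUnit, G.generator x] ∈ G.universalCones 2 := by
  obtain ⟨e, he, hx⟩ := G.exists_mem_edge x
  have hnonneg : 0 ≤ ![1, (G.edges.card : ℂ) • G.delta ⟨e, he⟩ ⟨x, hx⟩] := by
    have hdelta : 0 ≤ G.delta ⟨e, he⟩ ⟨x, hx⟩ := by simp [delta]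
    intro i
    fin_cases i
    · exact zero_le_one
    · exact smul_nonneg (Nat.cast_nonneg _) hdelta
  convert G.diagonal_mkQ_mem_universalCones hnonneg using 2
  ext i
  fin_cases i
  · rfl
  · simp [G.generator_eq x e he hx]

end Generators

section ModelOfState

variable [DecidableEq V] [DecidableEq W]
  {s : G.UniversalSystem ⊗[ℂ] H.UniversalSystem →ₗ[ℂ] ℂ}

theorem prod_mem_edges_prod {e : Finset V} (he : e ∈ G.edges) {f : Finset W}
    (hf : f ∈ H.edges) : e ×ˢ f ∈ (G.prod H).edges :=
  Finset.mem_image_of_mem _ (Finset.mk_mem_product he hf)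

theorem modelOf_nonneg (hs : s ∈ G.maxTensorStates H) (z : V × W) : 0 ≤ G.modelOf H s z :=
  hs.2 _ <| tmul_mem_positiveElements_maxTensorCones
    (G.diagonal_unit_generator_mem_universalCones z.1)
    (H.diagonal_unit_generator_mem_universalCones z.2)

theorem modelOf_injective : Function.Injective (G.modelOf H) := fun _ _ hst =>
  TensorProduct.ext <| G.universalSystem_hom_ext fun x =>
    H.universalSystem_hom_ext fun y => congrFun hst (x, y)

variable (s)

theorem sum_modelOf_left {e : Finset V} (he : e ∈ G.edges) (y : W) :
    ∑ x ∈ e, G.modelOf H s (x, y) = s (G.universalUnit ⊗ₜ H.generator y) := by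
  simp only [modelOf, ← G.sum_generator he, TensorProduct.sum_tmul, map_sum]

theorem sum_modelOf_right {f : Finset W} (hf : f ∈ H.edges) (x : V) :
    ∑ y ∈ f, G.modelOf H s (x, y) = s (G.generator x ⊗ₜ H.universalUnit) := by
  simp only [modelOf, ← H.sum_generator hf, TensorProduct.tmul_sum, map_sum]

theorem sum_modelOf_prod {e : Finset V} (he : e ∈ G.edges) {f : Finset W} (hf : f ∈ H.edges) :
    ∑ z ∈ e ×ˢ f, G.modelOf H s z = s (G.universalUnit ⊗ₜ H.universalUnit) := by
  simp only [Finset.sum_product_right, G.sum_modelOf_left H s he, ← H.sum_generator hf,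
    TensorProduct.tmul_sum, map_sum]

variable {s}

/-- The real part of `s ↦ p^s`, as a real-linear map defined on all linear functionals. On states
`p^s` is already real, so that nothing is lost. -/
noncomputable def realModelOf :
    (G.UniversalSystem ⊗[ℂ] H.UniversalSystem →ₗ[ℂ] ℂ) →ₗ[ℝ] (V × W → ℝ) where
  toFun s z := (G.modelOf H s z).re
  map_add' _ _ := by ext; simp [modelOf]
  map_smul' _ _ := by ext; simp [modelOf]

theorem realModelOf_apply (s : G.UniversalSystem ⊗[ℂ] H.UniversalSystem →ₗ[ℂ] ℂ) (z : V × W) :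
    G.realModelOf H s z = (G.modelOf H s z).re :=
  rfl

theorem ofReal_realModelOf (hs : s ∈ G.maxTensorStates H) (z : V × W) :
    (G.realModelOf H s z : ℂ) = G.modelOf H s z :=
  (Complex.eq_re_of_ofReal_le (r := 0) (by simpa using G.modelOf_nonneg H hs z)).symm

theorem realModelOf_mem_nsModels (hs : s ∈ G.maxTensorStates H) :
    G.realModelOf H s ∈ G.nsModels H := by
  refine ⟨(G.prod H).mem_models_of_nonneg
    (fun z => (Complex.nonneg_iff.1 (G.modelOf_nonneg H hs z)).1) ?_, ?_, ?_⟩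
  · intro g hg
    obtain ⟨⟨e, f⟩, hef, rfl⟩ := Finset.mem_image.1 hg
    obtain ⟨he, hf⟩ := Finset.mem_product.1 hef
    simp only [realModelOf_apply, ← Complex.re_sum, G.sum_modelOf_prod H s he hf, hs.1,
      Complex.one_re]
  · intro y e he e' he'
    simp only [realModelOf_apply, ← Complex.re_sum, G.sum_modelOf_left H s he,
      G.sum_modelOf_left H s he']
  · intro x f hf f' hf'
    simp only [realModelOf_apply, ← Complex.re_sum, G.sum_modelOf_right H s hf,
      G.sum_modelOf_right H s hf']

end ModelOfState

section StateOfModel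

/-- The coordinate functional `u ↦ u_x^e` of `⊕_e ℓ^∞_e`. -/
def coordinate (e : {e // e ∈ G.edges}) (x : {x // x ∈ e.1}) : G.DirectSumSystem →ₗ[ℂ] ℂ :=
  LinearMap.proj x ∘ₗ LinearMap.proj e

/-- The bilinear form `(u, v) ↦ ∑_{e, f} ∑_{x ∈ e, y ∈ f} p(x, y) u_x^e v_y^f`, the two-party
analogue of `pairing`. It is encoded as `∑_f ∑_{y ∈ f} ⟨p(·, y), u⟩ v_y^f`. -/
noncomputable def jointPairing (p : V × W → ℝ) :
    G.DirectSumSystem →ₗ[ℂ] H.DirectSumSystem →ₗ[ℂ] ℂ :=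
  ∑ f : {f // f ∈ H.edges}, ∑ y : {y // y ∈ f.1},
    (G.pairing fun x => p (x, y)).smulRight (H.coordinate f y)

theorem jointPairing_apply (p : V × W → ℝ) (u : G.DirectSumSystem) (v : H.DirectSumSystem) :
    G.jointPairing H p u v = ∑ f : {f // f ∈ H.edges}, ∑ y : {y // y ∈ f.1},
      G.pairing (fun x => p (x, y)) u * v f y := by
  simp [jointPairing, coordinate]

theorem posSemidef_map_pairing {q : V → ℝ} (hq : ∀ x, 0 ≤ q x) {n : ℕ}
    {P : Matrix (Fin n) (Fin n) G.DirectSumSystem} (hP : P ∈ G.directSumCones n) :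
    (P.map (G.pairing q)).PosSemidef := by
  have hsum : P.map (G.pairing q) = ∑ e : {e // e ∈ G.edges}, ∑ x : {x // x ∈ e.1},
      (q x : ℂ) • P.map fun u => u e x := by
    ext i j
    simp [pairing_apply, Matrix.sum_apply]
  rw [hsum]
  exact Matrix.posSemidef_sum _ fun e _ => Matrix.posSemidef_sum _ fun x _ =>
    (hP e x).smul (Complex.zero_le_real.2 (hq x))

theorem isJointlyCompletelyPositive_jointPairing {p : V × W → ℝ} (hp : ∀ z, 0 ≤ p z) :
    IsJointlyCompletelyPositive G.directSumCones H.directSumCones (G.jointPairing H p) :=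
  .sum fun f _ => .sum fun y _ => .smulRight
    (fun _ _ hP => G.posSemidef_map_pairing (fun x => hp (x, y)) hP) (fun _ _ hQ => hQ f y)

theorem modelKernel_le_ker_jointPairing {p : V × W → ℝ} (hp : ∀ z, 0 ≤ p z)
    (hns : ∀ y, ∀ e ∈ G.edges, ∀ e' ∈ G.edges, ∑ x ∈ e, p (x, y) = ∑ x ∈ e', p (x, y)) :
    G.modelKernel ≤ LinearMap.ker (G.jointPairing H p) := by
  intro u hu
  have hslice : ∀ y, G.pairing (fun x => p (x, y)) u = 0 := fun y =>
    G.modelKernel_le_ker_pairing (fun x => hp (x, y)) (hns y) hu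
  ext1 v
  simp [jointPairing_apply, hslice]

theorem jointPairing_delta_delta [DecidableEq V] [DecidableEq W] (p : V × W → ℝ)
    (e : {e // e ∈ G.edges}) (x : {x // x ∈ e.1}) (f : {f // f ∈ H.edges}) (y : {y // y ∈ f.1}) :
    G.jointPairing H p (G.delta e x) (H.delta f y) = p (x, y) := by
  simp only [jointPairing_apply, pairing_delta]
  exact H.pairing_delta (fun y => p (x, y)) f y

theorem jointPairing_flip (p : V × W → ℝ) :
    (G.jointPairing H p).flip = H.jointPairing G fun z => p z.swap := by
  classical
  refine H.directSumSystem_hom_ext fun f y => G.directSumSystem_hom_ext fun e x => ?_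
  simp only [LinearMap.flip_apply, jointPairing_delta_delta, Prod.swap_prod_mk]

variable [DecidableEq V] [DecidableEq W] {p : V × W → ℝ} (hp : p ∈ G.nsModels H)

/-- The bilinear form on `S_G × S_H` induced by a no-signalling model `p`, normalised by
`(|E| |F|)⁻¹` so that it takes the value `p(x, y)` at `(a_x, b_y)`. -/
noncomputable def nsForm : G.UniversalSystem →ₗ[ℂ] H.UniversalSystem →ₗ[ℂ] ℂ :=
  ((G.edges.card : ℂ) * H.edges.card)⁻¹ •
    (G.jointPairing H p).liftQ₂ G.modelKernel H.modelKernel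
      (G.modelKernel_le_ker_jointPairing H (fun z => (hp.1.1 z).1) hp.2.1)
      (G.jointPairing_flip H p ▸
        H.modelKernel_le_ker_jointPairing G (fun z => (hp.1.1 z.swap).1) hp.2.2)

theorem nsForm_compl₁₂_mkQ :
    (G.nsForm H hp).compl₁₂ G.modelKernel.mkQ H.modelKernel.mkQ =
      ((G.edges.card : ℂ) * H.edges.card)⁻¹ • G.jointPairing H p :=
  rfl

theorem nsForm_generator_generator (x : V) (y : W) :
    G.nsForm H hp (G.generator x) (H.generator y) = p (x, y) := by
  have hG := G.card_edges_ne_zero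
  have hH := H.card_edges_ne_zero
  simp only [nsForm, generator, Submodule.mkQ_apply, map_smul, LinearMap.smul_apply,
    LinearMap.liftQ₂_mk, jointPairing_delta_delta, smul_eq_mul]
  field_simp

theorem isJointlyCompletelyPositive_nsForm :
    IsJointlyCompletelyPositive G.universalCones H.universalCones (G.nsForm H hp) := by
  have hcard : 0 ≤ ((G.edges.card : ℂ) * H.edges.card)⁻¹ :=
    inv_nonneg.2 (mul_nonneg (Nat.cast_nonneg _) (Nat.cast_nonneg _))
  refine IsJointlyCompletelyPositive.quotientCones ?_ 1 1
  rw [nsForm_compl₁₂_mkQ]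
  exact (G.isJointlyCompletelyPositive_jointPairing H fun z => (hp.1.1 z).1).smul hcard

theorem modelOf_lift_nsForm (z : V × W) :
    G.modelOf H (TensorProduct.lift (G.nsForm H hp)) z = p z := by
  simp only [modelOf, TensorProduct.lift.tmul, nsForm_generator_generator]

theorem nsForm_unit_unit : G.nsForm H hp G.universalUnit H.universalUnit = 1 := by
  obtain ⟨e, he⟩ := G.edges_nonempty
  obtain ⟨f, hf⟩ := H.edges_nonempty
  rw [← TensorProduct.lift.tmul, ← G.sum_modelOf_prod H _ he hf]
  simp only [modelOf_lift_nsForm]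
  exact_mod_cast hp.1.2 _ (G.prod_mem_edges_prod H he hf)

theorem lift_nsForm_mem_maxTensorStates :
    TensorProduct.lift (G.nsForm H hp) ∈ G.maxTensorStates H :=
  (G.isJointlyCompletelyPositive_nsForm H hp).lift_mem_stateSpace (G.nsForm_unit_unit H hp)

end StateOfModel

theorem convex_maxTensorStates : Convex ℝ (G.maxTensorStates H) :=
  convex_stateSpace _ _

theorem bijOn_realModelOf [DecidableEq V] [DecidableEq W] :
    Set.BijOn (G.realModelOf H) (G.maxTensorStates H) (G.nsModels H) := by
  refine ⟨fun s hs => G.realModelOf_mem_nsModels H hs, fun s hs t ht hst => ?_, fun p hp => ?_⟩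
  · refine G.modelOf_injective H (funext fun z => ?_)
    rw [← G.ofReal_realModelOf H hs, ← G.ofReal_realModelOf H ht, hst]
  · refine ⟨_, G.lift_nsForm_mem_maxTensorStates H hp, funext fun z => ?_⟩
    rw [realModelOf_apply, modelOf_lift_nsForm, Complex.ofReal_re]

end ContextualityScenario

theorem mainTheorem2 {V W : Type*} [Fintype V] [Fintype W] [DecidableEq V] [DecidableEq W]
    (G : ContextualityScenario V) (H : ContextualityScenario W)
    (hG : G.IsNontrivial) (hH : H.IsNontrivial) :
    (∀ p ∈ (G.prod H).models,
      p ∈ G.nsModels H ↔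
        ∃ s ∈ G.maxTensorStates H, ∀ z : V × W, G.modelOf H s z = (p z : ℂ)) ∧
    ∃ Φ : G.maxTensorStates H → G.nsModels H,
      (∀ (s : G.maxTensorStates H) (z : V × W), G.modelOf H s z = ((Φ s : V × W → ℝ) z : ℂ)) ∧
      IsAffineIso Φ := by
  refine ⟨fun p _ => ⟨fun hp => ?_, ?_⟩, (G.bijOn_realModelOf H).mapsTo.restrict _ _ _,
    fun s z => (G.ofReal_realModelOf H s.2 z).symm,
    isAffineIso_of_bijOn (G.convex_maxTensorStates H) (G.bijOn_realModelOf H)⟩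
  · exact ⟨_, G.lift_nsForm_mem_maxTensorStates H hp, G.modelOf_lift_nsForm H hp⟩
  · rintro ⟨s, hs, hsp⟩
    have hp : p = G.realModelOf H s := funext fun z => by
      rw [G.realModelOf_apply, hsp, Complex.ofReal_re]
    exact hp ▸ G.realModelOf_mem_nsModels H hs
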